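/- Let $G$ be a Hausdorff topological group. A \emph{semigroup compactification} of $G$ is a pair $(\alpha G,\alpha)$ where $\alpha G$ is a compact Hausdorff space with a semigroup product such that $x\mapsto xy$ is continuous on $\alpha G$ for every $y\in\alpha G$, and $\alpha:G\to\alpha G$ is a continuous homomorphism with dense range such that $y\mapsto\alpha(s)y$ is continuous on $\alpha G$ for every $s\in G$. It is \emph{totally disconnected} if the space $\alpha G$ is. We write $(\alpha G,\alpha)\preceq(\gamma G,\gamma)$, and call $(\alpha G,\alpha)$ a \emph{factor} (or quotient) of $(\gamma G,\gamma)$, if there is a continuous map $h:\gamma G\to\alpha G$ with $h\circ\gamma=\alpha$. The \emph{projective maximum} of a set of semigroup compactifications is a member of which every member is a factor. For a property $\mathcal P$ of semigroup compactifications of $G$, $(\gamma G,\gamma)$ is \emph{universal} with respect to $\mathcal P$ if it is the projective maximum of the semigroup compactifications of $G$ that have $\mathcal P$. For $E\subseteq G$ and $s\in G$ put $E\cdot s=s^{-1}E$ and $s\cdot E=Es^{-1}$. For a Boolean algebra $\mathcal B$ of clopen subsets of $G$, let $\nu_{\mathcal B}G$ be its Stone space, i.e. the set of all ultrafilters (maximal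 filters) on $\mathcal B$ with the topology generated by the sets $\{\mathcal U: E\in\mathcal U\}$, $E\in\mathcal B$, and let $\nu_{\mathcal B}(s)=\{E\in\mathcal B: s\in E\}$ for $s\in G$. For $\mathcal V\in\nu_{\mathcal B}G$ and $E\in\mathcal B$ put $\mathcal V\cdot E=\{s\in G: E\cdot s\in\mathcal V\}$. The algebra $\mathcal B$ is \emph{left introverted} if $E\cdot s,\ s\cdot E,\ \mathcal V\cdot E\in\mathcal B$ for all $E\in\mathcal B$, $s\in G$, $\mathcal V\in\nu_{\mathcal B}G$; in this case $\nu_{\mathcal B}G$ carries the left Arens product $\mathcal U\mathbin{\square}\mathcal V=\{E\in\mathcal B:\mathcal V\cdot E\in\mathcal U\}$, with which $(\nu_{\mathcal B}G,\nu_{\mathcal B})$ is a semigroup compactification of $G$. \textbf{Theorem.} Let $(\gamma G,\gamma)$ be a semigroup compactification of $G$, let $\mathcal S^\gamma(G)=\{f\circ\gamma: f\in CB(\gamma G)\}$, where $CB$ denotes bounded continuous complex-valued functions, and let $\mathcal P$ be a property of semigroup compactifications of $G$ (for instance, a property of right topological semigroups). (i) The collection $$\mathcal B^\gamma=\{\gamma^{-1}(D):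 D\subseteq\gamma G\text{ clopen}\}=\{E\subseteq G: 1_E\in\mathcal S^\gamma(G)\}$$ (the two descriptions agree) is a left introverted Boolean algebra of clopen subsets of $G$, and $(\nu_{\mathcal B^\gamma}G,\nu_{\mathcal B^\gamma})$ is the projective maximum of the set of all totally disconnected semigroup compactifications $(\alpha G,\alpha)$ of $G$ with $(\alpha G,\alpha)\preceq(\gamma G,\gamma)$. (ii) Suppose that $(\gamma G,\gamma)$ is universal with respect to $\mathcal P$. If $(\alpha G,\alpha)$ is a totally disconnected semigroup compactification of $G$ that has $\mathcal P$, then $(\alpha G,\alpha)\preceq(\nu_{\mathcal B^\gamma}G,\nu_{\mathcal B^\gamma})$. If $(\nu_{\mathcal B^\gamma}G,\nu_{\mathcal B^\gamma})$ has $\mathcal P$, then it is the universal totally disconnected semigroup compactification of $G$ with $\mathcal P$, that is, it is universal with respect to the property of being totally disconnected and having $\mathcal P$. If $\mathcal P$ is preserved by quotients (every factor of a semigroup compactification of $G$ with $\mathcal P$ has $\mathcal P$), then $(\nu_{\mathcal B^\gamma}G,\nu_{\mathcal B^\gamma})$ does have $\mathcal P$, and so is this universal one. -/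

import Mathlib

universe u

/-! ### Semigroup compactifications -/

/-- A (right topological) semigroup compactification `(αG, α)` of `G`: a compact Hausdorff right
topological semigroup `αG` with a continuous homomorphism `α : G → αG` with dense range whose
range lies in the topological centre of `αG`. The underlying sets are taken in the universe of
`G`; by density of `α(G)` this is no restriction up to equivalence. -/
structure SemigroupCompactification (G : Type u) [Group G] [TopologicalSpace G] where
  carrier : Type u
  [semigroup : Semigroup carrier]
  [topology : TopologicalSpace carrier]
  [compact : CompactSpace carrier]
  [hausdorff : T2Space carrier]
  /-- the canonical homomorphism `α : G → αG` -/
  map : G →ₙ* carrier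
  continuous_map : Continuous map
  denseRange_map : DenseRange map
  continuous_mul_right : ∀ t : carrier, Continuous fun s : carrier => s * t
  continuous_map_mul : ∀ g : G, Continuous fun y : carrier => map g * y

attribute [instance] SemigroupCompactification.semigroup SemigroupCompactification.topology
  SemigroupCompactification.compact SemigroupCompactification.hausdorff

/-- `(αG, α)` is a factor of `(γG, γ)`: there is a continuous `h : γG → αG` with `h ∘ γ = α`. -/
def IsFactor {G : Type u} [Group G] [TopologicalSpace G]
    (α γ : SemigroupCompactification G) : Prop :=
  ∃ h : γ.carrier → α.carrier, Continuous h ∧ ∀ g : G, h (γ.map g) = α.map g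

/-- `γ` is totally disconnected. -/
def IsTD {G : Type u} [Group G] [TopologicalSpace G] (γ : SemigroupCompactification G) : Prop :=
  TotallyDisconnectedSpace γ.carrier

/-- `γ` is the projective maximum of `S`: it belongs to `S` and every member of `S` is a factor
of `γ`. -/
def IsProjectiveMaximum {G : Type u} [Group G] [TopologicalSpace G]
    (S : Set (SemigroupCompactification G)) (γ : SemigroupCompactification G) : Prop :=
  γ ∈ S ∧ ∀ α ∈ S, IsFactor α γ

/-- `γ` is universal with respect to `P`: it has `P`, and every semigroup compactification
with `P` is a factor of `γ`. -/
def IsUniversal {G : Type u} [Group G] [TopologicalSpace G]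
    (P : SemigroupCompactification G → Prop) (γ : SemigroupCompactification G) : Prop :=
  IsProjectiveMaximum {α | P α} γ

/-- `P` is preserved by quotients (factors) of semigroup compactifications. -/
def PreservedByQuotients {G : Type u} [Group G] [TopologicalSpace G]
    (P : SemigroupCompactification G → Prop) : Prop :=
  ∀ α γ : SemigroupCompactification G, IsFactor α γ → P γ → P α

/-! ### The Stone space of a Boolean algebra of sets -/

/-- `U` is a (proper) filter on the Boolean algebra `B` of subsets of `X`. -/
structure IsFilterOn {X : Type u} (B : BooleanSubalgebra (Set X)) (U : Set (Set X)) : Prop where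
  subset : ∀ E ∈ U, E ∈ B
  univ_mem : Set.univ ∈ U
  empty_notMem : ∅ ∉ U
  mono : ∀ E ∈ U, ∀ F ∈ B, E ⊆ F → F ∈ U
  inter : ∀ E ∈ U, ∀ F ∈ U, E ∩ F ∈ U

/-- The Stone space `ν_B X` of `B`: all ultrafilters (maximal filters) on `B`. -/
def StoneSpace {X : Type u} (B : BooleanSubalgebra (Set X)) : Type u :=
  {U : Set (Set X) // Maximal (IsFilterOn B) U}

/-- The set `λ_B(E)` of ultrafilters on `B` that contain `E`. -/
def stoneBasic {X : Type u} (B : BooleanSubalgebra (Set X)) (E : Set X) : Set (StoneSpace B) :=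
  {U | E ∈ U.1}

instance {X : Type u} (B : BooleanSubalgebra (Set X)) : TopologicalSpace (StoneSpace B) :=
  TopologicalSpace.generateFrom {S | ∃ E ∈ B, S = stoneBasic B E}

theorem maximal_isFilterOn_iff {X : Type u} {B : BooleanSubalgebra (Set X)} {U : Set (Set X)} :
    Maximal (IsFilterOn B) U ↔ IsFilterOn B U ∧ ∀ E ∈ B, E ∈ U ∨ Eᶜ ∈ U := by
  constructor
  · intro hU
    have hf := hU.prop
    refine ⟨hf, fun E hE => ?_⟩
    by_contra! hcon
    obtain ⟨h1, h2⟩ := hcon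
    apply h1
    have key : IsFilterOn B {F | F ∈ B ∧ ∃ A ∈ U, A ∩ E ⊆ F} := by
      refine ⟨fun F hF => hF.1, ⟨BooleanSubalgebra.top_mem, Set.univ, hf.univ_mem, by simp⟩,
        ?_, ?_, ?_⟩
      · rintro ⟨-, A, hA, hAE⟩
        refine h2 (hf.mono A hA _ (BooleanSubalgebra.compl_mem hE) fun x hx hxE => ?_)
        exact hAE ⟨hx, hxE⟩
      · rintro F ⟨-, A, hA, hAF⟩ F' hF' hFF'
        exact ⟨hF', A, hA, hAF.trans hFF'⟩
      · rintro F ⟨hF, A, hA, hAF⟩ F' ⟨hF', A', hA', hAF'⟩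
        exact ⟨BooleanSubalgebra.inf_mem hF hF', A ∩ A', hf.inter A hA A' hA',
          fun x hx => ⟨hAF ⟨hx.1.1, hx.2⟩, hAF' ⟨hx.1.2, hx.2⟩⟩⟩
    exact hU.le_of_ge key (fun A hA => ⟨hf.subset A hA, A, hA, Set.inter_subset_left⟩)
      ⟨hE, Set.univ, hf.univ_mem, by simp⟩
  · rintro ⟨hf, hc⟩
    refine ⟨hf, fun V hV hUV E hE => ?_⟩
    rcases hc E (hV.subset E hE) with h | h
    · exact h
    · exact absurd (by simpa using hV.inter E hE _ (hUV h)) hV.empty_notMem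

namespace StoneSpace

variable {X : Type u} {B : BooleanSubalgebra (Set X)}

theorem isFilterOn (U : StoneSpace B) : IsFilterOn B U.1 := U.2.prop

theorem mem_or (U : StoneSpace B) {E : Set X} (hE : E ∈ B) : E ∈ U.1 ∨ Eᶜ ∈ U.1 :=
  (maximal_isFilterOn_iff.1 U.2).2 E hE

theorem compl_mem_iff (U : StoneSpace B) {E : Set X} (hE : E ∈ B) : Eᶜ ∈ U.1 ↔ E ∉ U.1 := by
  constructor
  · intro h h'
    exact U.isFilterOn.empty_notMem (by simpa using U.isFilterOn.inter E h' _ h)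
  · intro h
    exact (U.mem_or hE).resolve_left h

theorem isOpen_stoneBasic {E : Set X} (hE : E ∈ B) : IsOpen (stoneBasic B E) :=
  TopologicalSpace.isOpen_generateFrom_of_mem ⟨E, hE, rfl⟩

instance : T2Space (StoneSpace B) := by
  refine ⟨fun U V hUV => ?_⟩
  have : ∃ E ∈ U.1, E ∉ V.1 := by
    by_contra! h
    exact hUV (Subtype.ext (Set.Subset.antisymm h (U.2.le_of_ge V.isFilterOn h)))
  obtain ⟨E, hEU, hEV⟩ := this
  have hE := U.isFilterOn.subset E hEU
  refine ⟨stoneBasic B E, stoneBasic B Eᶜ, isOpen_stoneBasic hE,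
    isOpen_stoneBasic (BooleanSubalgebra.compl_mem hE), hEU, (V.compl_mem_iff hE).2 hEV, ?_⟩
  exact Set.disjoint_left.2 fun W hW hW' => (W.compl_mem_iff hE).1 hW' hW

instance : CompactSpace (StoneSpace B) := by
  refine ⟨isCompact_iff_ultrafilter_le_nhds.2 fun F _ => ?_⟩
  let U : Set (Set X) := {E | E ∈ B ∧ ∀ᶠ V : StoneSpace B in F, E ∈ V.1}
  have hU : Maximal (IsFilterOn B) U := by
    refine maximal_isFilterOn_iff.2 ⟨⟨fun E hE => hE.1, ⟨BooleanSubalgebra.top_mem,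
      Filter.Eventually.of_forall fun V => V.isFilterOn.univ_mem⟩, ?_, ?_, ?_⟩, ?_⟩
    · rintro ⟨-, h⟩
      obtain ⟨V, hV⟩ := h.exists
      exact V.isFilterOn.empty_notMem hV
    · rintro E ⟨-, hE⟩ F hF hEF
      exact ⟨hF, hE.mono fun V hV => V.isFilterOn.mono E hV F hF hEF⟩
    · rintro E ⟨hE, hE'⟩ F ⟨hF, hF'⟩
      exact ⟨BooleanSubalgebra.inf_mem hE hF,
        (hE'.and hF').mono fun V hV => V.isFilterOn.inter E hV.1 F hV.2⟩
    · intro E hE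
      by_cases h : ∀ᶠ V : StoneSpace B in F, E ∈ V.1
      · exact Or.inl ⟨hE, h⟩
      · exact Or.inr ⟨BooleanSubalgebra.compl_mem hE,
          (Ultrafilter.eventually_not.2 h).mono fun V hV => (V.compl_mem_iff hE).2 hV⟩
  let W : StoneSpace B := ⟨U, hU⟩
  refine ⟨W, Set.mem_univ _, ?_⟩
  rw [TopologicalSpace.nhds_generateFrom]
  refine le_iInf₂ fun S hS => ?_
  obtain ⟨hUS, E, hE, rfl⟩ := hS
  exact Filter.le_principal_iff.2 hUS.2

/-- The canonical map `ν_B : X → ν_B X`, `x ↦ {E ∈ B : x ∈ E}`. -/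
def point (B : BooleanSubalgebra (Set X)) (x : X) : StoneSpace B :=
  ⟨{E | E ∈ B ∧ x ∈ E}, maximal_isFilterOn_iff.2
    ⟨⟨fun _ h => h.1, ⟨BooleanSubalgebra.top_mem, Set.mem_univ x⟩, fun h => h.2,
      fun _ h _ hF hEF => ⟨hF, hEF h.2⟩,
      fun _ h _ h' => ⟨BooleanSubalgebra.inf_mem h.1 h'.1, h.2, h'.2⟩⟩,
      fun E hE => (em (x ∈ E)).imp (fun h => ⟨hE, h⟩)
        fun h => ⟨BooleanSubalgebra.compl_mem hE, h⟩⟩⟩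

theorem mem_point {x : X} {E : Set X} : E ∈ (point B x).1 ↔ E ∈ B ∧ x ∈ E := Iff.rfl

theorem continuous_point [TopologicalSpace X] (hB : ∀ E ∈ B, IsClopen E) :
    Continuous (point B) := by
  refine continuous_generateFrom_iff.2 ?_
  rintro _ ⟨E, hE, rfl⟩
  have : point B ⁻¹' stoneBasic B E = E := by
    ext x
    exact ⟨fun h => h.2, fun h => ⟨hE, h⟩⟩
  rw [this]
  exact (hB E hE).isOpen

theorem denseRange_point : DenseRange (point B) := by
  have hb : TopologicalSpace.IsTopologicalBasis
      {S | ∃ E ∈ B, S = stoneBasic B E} := by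
    refine ⟨?_, ?_, rfl⟩
    · rintro _ ⟨E, hE, rfl⟩ _ ⟨F, hF, rfl⟩ U hU
      refine ⟨_, ⟨E ∩ F, BooleanSubalgebra.inf_mem hE hF, rfl⟩,
        U.isFilterOn.inter E hU.1 F hU.2, fun V hV => ?_⟩
      exact ⟨V.isFilterOn.mono _ hV E hE Set.inter_subset_left,
        V.isFilterOn.mono _ hV F hF Set.inter_subset_right⟩
    · refine Set.eq_univ_of_forall fun U => ?_
      exact ⟨_, ⟨Set.univ, BooleanSubalgebra.top_mem, rfl⟩, U.isFilterOn.univ_mem⟩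
  refine hb.dense_iff.2 ?_
  rintro _ ⟨E, hE, rfl⟩ ⟨U, hU⟩
  rcases E.eq_empty_or_nonempty with rfl | ⟨x, hx⟩
  · exact absurd hU U.isFilterOn.empty_notMem
  · exact ⟨point B x, ⟨hE, hx⟩, x, rfl⟩

end StoneSpace

/-! ### Introverted Boolean algebras and the Arens product -/

/-- `E · s = s⁻¹ E`. -/
def actRight {G : Type u} [Group G] (E : Set G) (s : G) : Set G := (fun b => s⁻¹ * b) '' E

/-- `s · E = E s⁻¹`. -/
def actLeft {G : Type u} [Group G] (s : G) (E : Set G) : Set G := (fun b => b * s⁻¹) '' E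

/-- `C · E = {s : E · s ∈ C}` for a collection `C` of subsets of `G`. -/
def collectionAct {G : Type u} [Group G] (C : Set (Set G)) (E : Set G) : Set G :=
  {s | actRight E s ∈ C}

/-- `B` is a left introverted Boolean algebra of clopen subsets of `G`. -/
structure LeftIntroverted {G : Type u} [Group G] [TopologicalSpace G]
    (B : BooleanSubalgebra (Set G)) : Prop where
  isClopen : ∀ E ∈ B, IsClopen E
  actRight_mem : ∀ E ∈ B, ∀ s : G, actRight E s ∈ B
  actLeft_mem : ∀ E ∈ B, ∀ s : G, actLeft s E ∈ B
  collectionAct_mem : ∀ V : StoneSpace B, ∀ E ∈ B, collectionAct V.1 E ∈ B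

theorem mem_actRight {G : Type u} [Group G] {E : Set G} {s t : G} :
    t ∈ actRight E s ↔ s * t ∈ E := by
  constructor
  · rintro ⟨b, hb, rfl⟩
    simpa using hb
  · exact fun h => ⟨s * t, h, by simp⟩

theorem mem_actLeft {G : Type u} [Group G] {E : Set G} {s t : G} :
    t ∈ actLeft s E ↔ t * s ∈ E := by
  constructor
  · rintro ⟨b, hb, rfl⟩
    simpa using hb
  · exact fun h => ⟨t * s, h, by simp⟩

theorem actRight_collectionAct {G : Type u} [Group G] (C : Set (Set G)) (E : Set G) (s : G) :
    actRight (collectionAct C E) s = collectionAct C (actRight E s) := by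
  ext t
  have : actRight E (s * t) = actRight (actRight E s) t := by
    ext x
    simp [mem_actRight, mul_assoc]
  rw [mem_actRight]
  simp only [collectionAct, Set.mem_ofPred_eq, this]

/-- The left Arens product `U □ V = {E ∈ B : V · E ∈ U}`. -/
def arensProduct {G : Type u} [Group G] [TopologicalSpace G] {B : BooleanSubalgebra (Set G)}
    (hB : LeftIntroverted B) (U V : StoneSpace B) : StoneSpace B :=
  ⟨{E | E ∈ B ∧ collectionAct V.1 E ∈ U.1}, by
    refine maximal_isFilterOn_iff.2 ⟨⟨fun E h => h.1, ⟨BooleanSubalgebra.top_mem, ?_⟩, ?_, ?_, ?_⟩,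
      ?_⟩
    · convert U.isFilterOn.univ_mem
      refine Set.eq_univ_of_forall fun s => ?_
      have : actRight (Set.univ : Set G) s = Set.univ :=
        Set.eq_univ_of_forall fun t => mem_actRight.2 (Set.mem_univ _)
      simpa only [collectionAct, Set.mem_ofPred_eq, this] using V.isFilterOn.univ_mem
    · rintro ⟨-, h⟩
      apply U.isFilterOn.empty_notMem
      convert h
      refine (Set.eq_empty_of_forall_notMem fun s hs => V.isFilterOn.empty_notMem ?_).symm
      simpa [collectionAct, actRight] using hs
    · rintro E ⟨hE, hE'⟩ F hF hEF
      refine ⟨hF, U.isFilterOn.mono _ hE' _ (hB.collectionAct_mem V F hF) fun s hs => ?_⟩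
      exact V.isFilterOn.mono _ hs _ (hB.actRight_mem F hF s) (Set.image_mono hEF)
    · rintro E ⟨hE, hE'⟩ F ⟨hF, hF'⟩
      have hEF : E ∩ F ∈ B := BooleanSubalgebra.inf_mem hE hF
      refine ⟨hEF, U.isFilterOn.mono _ (U.isFilterOn.inter _ hE' _ hF') _
        (hB.collectionAct_mem V _ hEF) fun s hs => ?_⟩
      refine V.isFilterOn.mono _ (V.isFilterOn.inter _ hs.1 _ hs.2) _
        (hB.actRight_mem _ hEF s) fun t ht => ?_
      exact mem_actRight.2 ⟨mem_actRight.1 ht.1, mem_actRight.1 ht.2⟩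
    · intro E hE
      refine (U.mem_or (hB.collectionAct_mem V E hE)).imp (fun h => ⟨hE, h⟩) fun h => ?_
      refine ⟨BooleanSubalgebra.compl_mem hE, ?_⟩
      convert h using 1
      ext s
      have : actRight Eᶜ s = (actRight E s)ᶜ := by
        ext t
        simp [mem_actRight]
      simp only [collectionAct, Set.mem_ofPred_eq, Set.mem_compl_iff, this]
      exact V.compl_mem_iff (hB.actRight_mem E hE s)⟩

theorem mem_arensProduct {G : Type u} [Group G] [TopologicalSpace G]
    {B : BooleanSubalgebra (Set G)} (hB : LeftIntroverted B) (U V : StoneSpace B) {E : Set G} :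
    E ∈ (arensProduct hB U V).1 ↔ E ∈ B ∧ collectionAct V.1 E ∈ U.1 := Iff.rfl

/-- The semigroup `(ν_B G, □)`. -/
@[reducible] def arensSemigroup {G : Type u} [Group G] [TopologicalSpace G]
    {B : BooleanSubalgebra (Set G)} (hB : LeftIntroverted B) : Semigroup (StoneSpace B) where
  mul := arensProduct hB
  mul_assoc := by
    intro U V W
    refine Subtype.ext (Set.ext fun E => ?_)
    change E ∈ (arensProduct hB (arensProduct hB U V) W).1 ↔
      E ∈ (arensProduct hB U (arensProduct hB V W)).1
    rw [mem_arensProduct, mem_arensProduct, mem_arensProduct]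
    refine and_congr_right fun hE => ?_
    have : collectionAct (arensProduct hB V W).1 E
        = collectionAct V.1 (collectionAct W.1 E) := by
      ext s
      simp only [collectionAct, Set.mem_ofPred_eq]
      rw [mem_arensProduct]
      have h := actRight_collectionAct W.1 E s
      simp only [collectionAct] at h ⊢
      rw [h]
      exact and_iff_right (hB.actRight_mem E hE s)
    rw [this]
    exact and_iff_right (hB.collectionAct_mem W E hE)

/-- The semigroup compactification `(ν_B G, ν_B, □)` of a left introverted Boolean algebra `B`. -/
def stoneCompactification {G : Type u} [Group G] [TopologicalSpace G]
    (B : BooleanSubalgebra (Set G)) (hB : LeftIntroverted B) : SemigroupCompactification G where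
  carrier := StoneSpace B
  semigroup := arensSemigroup hB
  map :=
    letI := arensSemigroup hB
    { toFun := StoneSpace.point B
      map_mul' := by
        intro s t
        refine Subtype.ext (Set.ext fun E => ?_)
        change E ∈ (StoneSpace.point B (s * t)).1 ↔
          E ∈ (arensProduct hB (StoneSpace.point B s) (StoneSpace.point B t)).1
        rw [mem_arensProduct, StoneSpace.mem_point, StoneSpace.mem_point]
        refine and_congr_right fun hE => ?_
        rw [and_iff_right (hB.collectionAct_mem _ E hE)]
        simp only [collectionAct, Set.mem_ofPred_eq, StoneSpace.mem_point, mem_actRight]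
        exact (and_iff_right (hB.actRight_mem E hE s)).symm }
  continuous_map := StoneSpace.continuous_point hB.isClopen
  denseRange_map := StoneSpace.denseRange_point
  continuous_mul_right := by
    intro V
    refine continuous_generateFrom_iff.2 ?_
    rintro _ ⟨E, hE, rfl⟩
    convert StoneSpace.isOpen_stoneBasic (hB.collectionAct_mem V E hE) using 1
    ext U
    exact and_iff_right hE
  continuous_map_mul := by
    intro s
    refine continuous_generateFrom_iff.2 ?_
    rintro _ ⟨E, hE, rfl⟩
    convert StoneSpace.isOpen_stoneBasic (hB.actRight_mem E hE s) using 1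
    ext V
    change (E ∈ B ∧ collectionAct V.1 E ∈ B ∧ s ∈ collectionAct V.1 E) ↔ _
    rw [and_iff_right hE, and_iff_right (hB.collectionAct_mem V E hE)]
    exact Iff.rfl

/-! ### The Boolean algebra and the function algebra of a semigroup compactification -/

/-- `S^γ(G) = CB(γG) ∘ γ`, as a subset of `CB(G)`. -/
def functionAlgebra {G : Type u} [Group G] [TopologicalSpace G]
    (γ : SemigroupCompactification G) : Set (BoundedContinuousFunction G ℂ) :=
  {φ | ∃ f : BoundedContinuousFunction γ.carrier ℂ,
    φ = f.compContinuous ⟨γ.map, γ.continuous_map⟩}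

/-- `B^γ = {γ⁻¹(D) : D clopen in γG}`. -/
def clopenAlgebra {G : Type u} [Group G] [TopologicalSpace G]
    (γ : SemigroupCompactification G) : BooleanSubalgebra (Set G) where
  carrier := {E | ∃ D : Set γ.carrier, IsClopen D ∧ E = γ.map ⁻¹' D}
  supClosed' := by
    rintro _ ⟨D, hD, rfl⟩ _ ⟨D', hD', rfl⟩
    exact ⟨D ∪ D', hD.union hD', rfl⟩
  infClosed' := by
    rintro _ ⟨D, hD, rfl⟩ _ ⟨D', hD', rfl⟩
    exact ⟨D ∩ D', hD.inter hD', rfl⟩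
  compl_mem' := by
    rintro _ ⟨D, hD, rfl⟩
    exact ⟨Dᶜ, hD.compl, rfl⟩
  bot_mem' := ⟨∅, isClopen_empty, rfl⟩

/-!
The map `γ⁻¹` is an isomorphism from the clopen subsets of `γG` onto `B^γ`, because `γ(G)` is
dense (`preimage_subset_preimage_iff`). Hence every point `x` of `γG` gives the ultrafilter
`clopenTrace γ x = {γ⁻¹(D) : D clopen, x ∈ D}` on `B^γ`, and by compactness of `γG` every
ultrafilter on `B^γ` arises in this way (`clopenTrace_surjective`).

If `V` is the trace of `x` and `E = γ⁻¹(D)`, then `V · E = γ⁻¹{y : y x ∈ D}`, a member of `B^γ`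
because right translation by `x` is continuous; so `B^γ` is left introverted
(`leftIntroverted_clopenAlgebra`).

The trace map is a continuous surjection from a compact space to a Hausdorff space, hence a quotient
map, and it makes the Stone space of `B^γ` a factor of `γG`. Its fibres are the classes of points
not separated by clopen sets, so every continuous map from `γG` to a totally disconnected
compact Hausdorff space descends to the Stone space (`isFactor_stoneCompactification`). This is
maximality; the assertions on universal compactifications follow formally.
-/

/-! ### Stone spaces -/

theorem StoneSpace.isClopen_stoneBasic {X : Type u} {B : BooleanSubalgebra (Set X)} {E : Set X}
    (hE : E ∈ B) : IsClopen (stoneBasic B E) := by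
  refine ⟨⟨?_⟩, StoneSpace.isOpen_stoneBasic hE⟩
  convert StoneSpace.isOpen_stoneBasic (BooleanSubalgebra.compl_mem hE) using 1
  ext U
  exact (U.compl_mem_iff hE).symm

theorem StoneSpace.ext_of_subset {X : Type u} {B : BooleanSubalgebra (Set X)} {U V : StoneSpace B}
    (h : U.1 ⊆ V.1) : U = V :=
  Subtype.ext (h.antisymm (U.2.le_of_ge V.isFilterOn h))

instance {X : Type u} {B : BooleanSubalgebra (Set X)} : TotallySeparatedSpace (StoneSpace B) := by
  refine totallySeparatedSpace_iff_exists_isClopen.2 fun U V hUV => ?_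
  obtain ⟨E, hEU, hEV⟩ := Set.not_subset.1 fun h => hUV (StoneSpace.ext_of_subset h)
  exact ⟨stoneBasic B E, StoneSpace.isClopen_stoneBasic (U.isFilterOn.subset E hEU), hEU, hEV⟩

section

variable {G : Type u} [Group G] [TopologicalSpace G]

/-! ### The clopen algebra and its ultrafilters -/

theorem preimage_mem_clopenAlgebra {γ : SemigroupCompactification G} {D : Set γ.carrier}
    (hD : IsClopen D) : γ.map ⁻¹' D ∈ clopenAlgebra γ := ⟨D, hD, rfl⟩

theorem preimage_subset_preimage_iff {γ : SemigroupCompactification G} {D D' : Set γ.carrier}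
    (hD : IsOpen D) (hD' : IsClosed D') : γ.map ⁻¹' D ⊆ γ.map ⁻¹' D' ↔ D ⊆ D' := by
  refine ⟨fun h x hx => ?_, fun h => Set.preimage_mono h⟩
  by_contra hx'
  obtain ⟨g, hg⟩ := γ.denseRange_map.exists_mem_open (hD.sdiff hD') ⟨x, hx, hx'⟩
  exact hg.2 (h hg.1)

/-- The ultrafilter `{γ⁻¹(D) : D clopen, x ∈ D}` on `B^γ` given by a point `x` of `γG`. -/
def clopenTrace (γ : SemigroupCompactification G) (x : γ.carrier) :
    StoneSpace (clopenAlgebra γ) :=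
  ⟨{E | ∃ D : Set γ.carrier, IsClopen D ∧ x ∈ D ∧ E = γ.map ⁻¹' D}, by
    refine maximal_isFilterOn_iff.2 ⟨⟨?_, ⟨Set.univ, isClopen_univ, trivial, rfl⟩, ?_, ?_, ?_⟩, ?_⟩
    · rintro _ ⟨D, hD, -, rfl⟩
      exact preimage_mem_clopenAlgebra hD
    · rintro ⟨D, hD, hx, h⟩
      exact (preimage_subset_preimage_iff hD.isOpen isClosed_empty).1 h.ge hx
    · rintro _ ⟨D, hD, hx, rfl⟩ _ ⟨D', hD', rfl⟩ h
      exact ⟨D', hD', (preimage_subset_preimage_iff hD.isOpen hD'.isClosed).1 h hx, rfl⟩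
    · rintro _ ⟨D, hD, hx, rfl⟩ _ ⟨D', hD', hx', rfl⟩
      exact ⟨D ∩ D', hD.inter hD', ⟨hx, hx'⟩, rfl⟩
    · rintro _ ⟨D, hD, rfl⟩
      exact (em (x ∈ D)).imp (fun h => ⟨D, hD, h, rfl⟩) fun h => ⟨Dᶜ, hD.compl, h, rfl⟩⟩

theorem preimage_mem_clopenTrace {γ : SemigroupCompactification G} {D : Set γ.carrier}
    (hD : IsClopen D) {x : γ.carrier} : γ.map ⁻¹' D ∈ (clopenTrace γ x).1 ↔ x ∈ D := by
  refine ⟨?_, fun h => ⟨D, hD, h, rfl⟩⟩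
  rintro ⟨D', hD', hx, h⟩
  exact (preimage_subset_preimage_iff hD'.isOpen hD.isClosed).1 h.ge hx

theorem clopenTrace_map (γ : SemigroupCompactification G) (g : G) :
    clopenTrace γ (γ.map g) = StoneSpace.point (clopenAlgebra γ) g := by
  refine StoneSpace.ext_of_subset ?_
  rintro _ ⟨D, hD, hg, rfl⟩
  exact ⟨preimage_mem_clopenAlgebra hD, hg⟩

theorem continuous_clopenTrace (γ : SemigroupCompactification G) :
    Continuous (clopenTrace γ) := by
  refine continuous_generateFrom_iff.2 ?_
  rintro _ ⟨_, ⟨D, hD, rfl⟩, rfl⟩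
  convert hD.isOpen using 1
  ext x
  exact preimage_mem_clopenTrace hD

theorem clopenTrace_surjective (γ : SemigroupCompactification G) :
    Function.Surjective (clopenTrace γ) := by
  intro V
  -- By compactness, the clopen sets whose preimages lie in `V` have a common point.
  obtain ⟨x, hx⟩ : (⋂ D : {D : Set γ.carrier // IsClopen D ∧ γ.map ⁻¹' D ∈ V.1}, D.1).Nonempty := by
    have : Nonempty {D : Set γ.carrier // IsClopen D ∧ γ.map ⁻¹' D ∈ V.1} :=
      ⟨⟨Set.univ, isClopen_univ, V.isFilterOn.univ_mem⟩⟩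
    refine IsCompact.nonempty_iInter_of_directed_nonempty_isCompact_isClosed _ ?_ ?_
      (fun D => D.2.1.isClosed.isCompact) (fun D => D.2.1.isClosed)
    · rintro ⟨D, hD, hDV⟩ ⟨D', hD', hDV'⟩
      exact ⟨⟨D ∩ D', hD.inter hD', V.isFilterOn.inter _ hDV _ hDV'⟩,
        Set.inter_subset_left, Set.inter_subset_right⟩
    · rintro ⟨D, hD, hDV⟩
      rw [Set.nonempty_iff_ne_empty]
      rintro rfl
      exact V.isFilterOn.empty_notMem hDV
  refine ⟨x, (StoneSpace.ext_of_subset fun E hE => ?_).symm⟩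
  obtain ⟨D, hD, rfl⟩ := V.isFilterOn.subset E hE
  exact ⟨D, hD, Set.mem_iInter.1 hx ⟨D, hD, hE⟩, rfl⟩

theorem isQuotientMap_clopenTrace (γ : SemigroupCompactification G) :
    Topology.IsQuotientMap (clopenTrace γ) :=
  (continuous_clopenTrace γ).isClosedMap.isQuotientMap (continuous_clopenTrace γ)
    (clopenTrace_surjective γ)

/-! ### Introversion -/

theorem actRight_preimage (γ : SemigroupCompactification G) (D : Set γ.carrier) (s : G) :
    actRight (γ.map ⁻¹' D) s = γ.map ⁻¹' ((fun y => γ.map s * y) ⁻¹' D) := by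
  ext t
  simp [mem_actRight]

theorem actLeft_preimage (γ : SemigroupCompactification G) (D : Set γ.carrier) (s : G) :
    actLeft s (γ.map ⁻¹' D) = γ.map ⁻¹' ((fun y => y * γ.map s) ⁻¹' D) := by
  ext t
  simp [mem_actLeft]

theorem collectionAct_clopenTrace {γ : SemigroupCompactification G} {D : Set γ.carrier}
    (hD : IsClopen D) (x : γ.carrier) :
    collectionAct (clopenTrace γ x).1 (γ.map ⁻¹' D) = γ.map ⁻¹' ((fun y => y * x) ⁻¹' D) := by
  ext s
  change actRight (γ.map ⁻¹' D) s ∈ (clopenTrace γ x).1 ↔ _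
  rw [actRight_preimage, preimage_mem_clopenTrace (hD.preimage (γ.continuous_map_mul s))]
  exact Iff.rfl

theorem leftIntroverted_clopenAlgebra (γ : SemigroupCompactification G) :
    LeftIntroverted (clopenAlgebra γ) where
  isClopen := by
    rintro _ ⟨D, hD, rfl⟩
    exact hD.preimage γ.continuous_map
  actRight_mem := by
    rintro _ ⟨D, hD, rfl⟩ s
    exact ⟨_, hD.preimage (γ.continuous_map_mul s), actRight_preimage γ D s⟩
  actLeft_mem := by
    rintro _ ⟨D, hD, rfl⟩ s
    exact ⟨_, hD.preimage (γ.continuous_mul_right (γ.map s)), actLeft_preimage γ D s⟩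
  collectionAct_mem := by
    rintro V _ ⟨D, hD, rfl⟩
    obtain ⟨x, rfl⟩ := clopenTrace_surjective γ V
    exact ⟨_, hD.preimage (γ.continuous_mul_right x), collectionAct_clopenTrace hD x⟩

/-! ### Indicator functions -/

theorem mem_clopenAlgebra_iff_indicator (γ : SemigroupCompactification G) (E : Set G) :
    E ∈ clopenAlgebra γ ↔ ∃ φ ∈ functionAlgebra γ, (φ : G → ℂ) = Set.indicator E 1 := by
  constructor
  · rintro ⟨D, hD, rfl⟩
    have hc : Continuous (Set.indicator D (1 : γ.carrier → ℂ)) :=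
      hD.continuous_indicator continuous_one
    refine ⟨_, ⟨BoundedContinuousFunction.mkOfCompact ⟨_, hc⟩, rfl⟩, ?_⟩
    ext g
    by_cases hg : γ.map g ∈ D <;> simp [Set.indicator, hg]
  · rintro ⟨_, ⟨f, rfl⟩, hf⟩
    have hfg : ∀ g, f (γ.map g) = Set.indicator E 1 g := fun g => congrFun hf g
    -- The equation `f² = f` holds on the dense subset `γ(G)`, so `f` is the indicator of
    -- the clopen set `f⁻¹{1}`.
    have hidem : ∀ x, f x * f x = f x := by
      refine fun x => congrFun (γ.denseRange_map.equalizer (f.continuous.mul f.continuous)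
        f.continuous (funext fun g => ?_)) x
      by_cases hg : g ∈ E <;> simp [hfg, hg]
    have h01 : (f ⁻¹' {1})ᶜ = f ⁻¹' {0} := by
      ext x
      rcases IsIdempotentElem.iff_eq_zero_or_one.1 (hidem x) with h | h <;> simp [h]
    refine ⟨f ⁻¹' {1}, ⟨isClosed_singleton.preimage f.continuous, ?_⟩, ?_⟩
    · rw [← isClosed_compl_iff, h01]
      exact isClosed_singleton.preimage f.continuous
    · ext g
      by_cases hg : g ∈ E <;> simp [hfg, hg]

/-! ### Factors of the Stone compactification -/

theorem stoneCompactification_isFactor (γ : SemigroupCompactification G) :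
    IsFactor (stoneCompactification (clopenAlgebra γ) (leftIntroverted_clopenAlgebra γ)) γ :=
  ⟨clopenTrace γ, continuous_clopenTrace γ, clopenTrace_map γ⟩

theorem isTD_stoneCompactification {B : BooleanSubalgebra (Set G)} (hB : LeftIntroverted B) :
    IsTD (stoneCompactification B hB) :=
  inferInstanceAs (TotallyDisconnectedSpace (StoneSpace B))

theorem isFactor_stoneCompactification {α γ : SemigroupCompactification G} (hα : IsTD α)
    (h : IsFactor α γ) :
    IsFactor α (stoneCompactification (clopenAlgebra γ) (leftIntroverted_clopenAlgebra γ)) := by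
  obtain ⟨h, hc, hg⟩ := h
  have : TotallyDisconnectedSpace α.carrier := hα
  have : TotallySeparatedSpace α.carrier := inferInstance
  -- A clopen set separating `h x` from `h y` pulls back to one separating `x` from `y`.
  have hfib : ∀ x y, clopenTrace γ x = clopenTrace γ y → h x = h y := by
    intro x y hxy
    by_contra hne
    obtain ⟨D, hD, hx, hy⟩ := exists_isClopen_of_totally_separated hne
    have hD' := hD.preimage hc
    have hx' := (preimage_mem_clopenTrace hD').2 hx
    rw [hxy] at hx'
    exact hy ((preimage_mem_clopenTrace hD').1 hx')
  let q : C(γ.carrier, StoneSpace (clopenAlgebra γ)) := ⟨clopenTrace γ, continuous_clopenTrace γ⟩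
  have hq : Topology.IsQuotientMap q := isQuotientMap_clopenTrace γ
  let k := hq.lift ⟨h, hc⟩ hfib
  have hk : ∀ x, k (clopenTrace γ x) = h x :=
    fun x => congrArg (fun f : C(γ.carrier, α.carrier) => f x) (hq.lift_comp ⟨h, hc⟩ hfib)
  refine ⟨k, k.continuous, fun g => ?_⟩
  change k (StoneSpace.point (clopenAlgebra γ) g) = α.map g
  rw [← clopenTrace_map, hk, hg]

end

theorem mainTheorem12 {G : Type u} [Group G] [TopologicalSpace G] [IsTopologicalGroup G]
    [T2Space G] (γ : SemigroupCompactification G) :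
    (clopenAlgebra γ : Set (Set G)) =
        {E | ∃ φ ∈ functionAlgebra γ, (φ : G → ℂ) = Set.indicator E 1} ∧
      ∃ hB : LeftIntroverted (clopenAlgebra γ),
        IsProjectiveMaximum {α | IsTD α ∧ IsFactor α γ}
          (stoneCompactification (clopenAlgebra γ) hB) ∧
        ∀ P : SemigroupCompactification G → Prop, IsUniversal P γ →
          (∀ α, IsTD α → P α → IsFactor α (stoneCompactification (clopenAlgebra γ) hB)) ∧
          (P (stoneCompactification (clopenAlgebra γ) hB) →
            IsUniversal (fun α => IsTD α ∧ P α)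
              (stoneCompactification (clopenAlgebra γ) hB)) ∧
          (PreservedByQuotients P →
            P (stoneCompactification (clopenAlgebra γ) hB) ∧
              IsUniversal (fun α => IsTD α ∧ P α)
                (stoneCompactification (clopenAlgebra γ) hB)) := by
  refine ⟨Set.ext fun E => mem_clopenAlgebra_iff_indicator γ E, leftIntroverted_clopenAlgebra γ,
    ⟨⟨isTD_stoneCompactification _, stoneCompactification_isFactor γ⟩,
      fun α hα => isFactor_stoneCompactification hα.1 hα.2⟩, fun P hP => ?_⟩
  have hmax : ∀ α, IsTD α → P α → IsFactor α
      (stoneCompactification (clopenAlgebra γ) (leftIntroverted_clopenAlgebra γ)) :=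
    fun α hα hPα => isFactor_stoneCompactification hα (hP.2 α hPα)
  have huniv : P (stoneCompactification (clopenAlgebra γ) (leftIntroverted_clopenAlgebra γ)) →
      IsUniversal (fun α => IsTD α ∧ P α)
        (stoneCompactification (clopenAlgebra γ) (leftIntroverted_clopenAlgebra γ)) :=
    fun h => ⟨⟨isTD_stoneCompactification _, h⟩, fun α hα => hmax α hα.1 hα.2⟩
  refine ⟨hmax, huniv, fun hquot => ?_⟩
  have h := hquot _ γ (stoneCompactification_isFactor γ) hP.1
  exact ⟨h, huniv h⟩
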